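/- Let $T$ be a first-order theory and let $\mathbb{O}$ be a monster model of $T$: $\mathbb{O}$ is $\kappa$-saturated and strongly $\kappa$-homogeneous for some $\kappa>\aleph_0$. Let $A\subseteq\mathbb{O}$ with $|A|<\kappa$. Fix an infinite cardinal $\nu\le\kappa$; below, $x,y,x_0,x_1,\dots$ denote tuples of distinct variables of length less than $\nu$ (so $\nu=\aleph_0$ gives finite tuples and $\nu=\kappa$ gives small tuples). *Invariant types.* A global type $p(x)\in S_x(\mathbb{O})$ is *$A$-invariant* if it is fixed by $\mathrm{Aut}(\mathbb{O}/A)$. It is *extendibly $A$-invariant* if for every $q(x,y)\in S(A)$ extending $p\restriction A$, $p(x)\cup q(x,y)$ extends to a global $A$-invariant type. A finite sequence $(b_i)_{i<n}$ of tuples in $\mathbb{O}$ is an *invariant sequence over $A$* if $b_i\equiv_A b_j$ for all $i<j<n$ and, for all $i<n$, $\mathrm{tp}(b_i/A\,b_{<i})$ extends to a global $A$-invariant type. A global type is *reliably $A$-invariant* if it belongs to the largest class $\mathcal{R}$ of $A$-invariant global types (in tuples of variables as above, identified up to renaming of variables) such that 1. for every $p(x,y)\in\mathcal{R}$, the restriction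 of $p$ to $x$ is in $\mathcal{R}$; 2. for every $p(x)\in\mathcal{R}$ and every $q(x,y)\in S(A)$ extending $p\restriction A$, there is $r(x,y)\in\mathcal{R}$ extending $p(x)\cup q(x,y)$; 3. for every $p(x_0)\in\mathcal{R}$ and every $q(x_0,\dots,x_{n-1})\in S(A)$ with $n\ge 1$ extending $(p\restriction A)(x_0)$, if $q$ is the type over $A$ of an invariant sequence over $A$, then there is $r(x_0,\dots,x_{n-1})\in\mathcal{R}$ extending $p(x_0)\cup\dots\cup p(x_{n-1})\cup q(x_0,\dots,x_{n-1})$. *Kim-dividing.* For an $A$-invariant type $p(y)$, a *Morley sequence generated by $p$* (over $A$) is a sequence $(e_i)_{i<\omega}$ in $\mathbb{O}$ with $e_i\models p\restriction A\,e_{<i}$ for all $i$. A formula $\varphi(x,y)$ *$p$-Kim-divides* if $\{\varphi(x,e_i):i<\omega\}$ is inconsistent for some (equivalently, every) Morley sequence generated by $p$. *The comb tree property.* For $\sigma\in 2^{<\omega}$ let $[\sigma]=\{\tau\in 2^{<\omega}:\tau\supseteq\sigma\}$. The *right-combs* form the smallest class of subsets of $2^{<\omega}$ that contains all sets with at most one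 element and contains $X$ whenever there is $\sigma$ such that $X\subseteq[\sigma]\setminus\{\sigma\}$, $|X\cap[\sigma^\frown 0]|=1$, and $X\cap[\sigma^\frown 1]$ is a right-comb. $T$ has *CTP* if for some $k<\omega$ there are a formula $\varphi(x,y)$ (with $x,y$ finite) and a family $(b_\sigma)_{\sigma\in 2^{<\omega}}$ in a model of $T$ such that for every $\alpha\in 2^\omega$ the family $(\varphi(x,b_{\alpha\restriction n}))_{n<\omega}$ is $k$-inconsistent (any $k$ members with distinct indices are jointly inconsistent), while for every right-comb $X$ the set $\{\varphi(x,b_\sigma):\sigma\in X\}$ is consistent. **Statement.** Let $\varphi(x,y)$ be a formula, with $x$ and $y$ finite, let $p(y)$ be a reliably $A$-invariant type and let $q(y)$ be an extendibly $A$-invariant type such that $p\restriction A=q\restriction A$. If $\varphi(x,y)$ $q$-Kim-divides but does not $p$-Kim-divide, then $T$ has CTP. -/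

import Mathlib

open FirstOrder FirstOrder.Language Cardinal
open scoped FirstOrder

universe u v w

namespace KimTypes

/-! ## Complete types with parameters -/

section Types

variable {L : FirstOrder.Language.{u, v}} {M : Type w} [L.Structure M]

/-- `S_α(A)`: complete types over the parameter set `A ⊆ M` in the tuple of variables
`(x_i)_{i : α}`. -/
abbrev TypeOver (L : FirstOrder.Language.{u, v}) {M : Type w} [L.Structure M] (A : Set M) (α : Type*) :=
  (L[[A]].completeTheory M).CompleteType α

/-- `S_α(M)`: global types in the variables `(x_i)_{i : α}`, for `M` the monster model. -/
abbrev GlobalType (L : FirstOrder.Language.{u, v}) (M : Type w) [L.Structure M] (α : Type*) :=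
  (L[[M]].completeTheory M).CompleteType α

/-- The translation of formulas in the variables `α` over a language `L₁` to formulas in the
variables `β` over `L₂` given by `g : L₁ → L₂` on symbols and `f : α → β` on variables. -/
def translate {L₁ L₂ : FirstOrder.Language} (g : L₁ →ᴸ L₂) {α β : Type*} (f : α → β) :
    L₁[[α]] →ᴸ L₂[[β]] :=
  g.sumMap (LHom.constantsOnMap f)

/-- Pulling back a complete type along a translation. -/
def pullback {L₁ L₂ : FirstOrder.Language} (g : L₁ →ᴸ L₂) {T₁ : L₁.Theory} {T₂ : L₂.Theory}
    (hg : g.onTheory T₁ ⊆ T₂) {α β : Type*} (f : α → β) (p : T₂.CompleteType β) :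
    T₁.CompleteType α where
  toTheory := {φ | (translate g f).onSentence φ ∈ p}
  subset' := by
    rintro _ ⟨φ, hφ, rfl⟩
    refine p.subset ⟨g.onSentence φ, hg ⟨φ, hφ, rfl⟩, ?_⟩
    have h : ((L₂.lhomWithConstants β).comp g)
        = (translate g f).comp (L₁.lhomWithConstants α) := by
      ext <;> rfl
    have h' := congrArg (fun k : L₁ →ᴸ L₂[[β]] => k.onSentence φ) h
    simpa [LHom.onSentence, LHom.onFormula, LHom.comp_onBoundedFormula] using h'
  isMaximal' := by
    refine ⟨?_, fun φ => p.mem_or_not_mem ((translate g f).onSentence φ)⟩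
    refine Theory.isSatisfiable_of_isSatisfiable_onTheory (translate g f) ?_
    refine p.isMaximal.1.mono ?_
    rintro _ ⟨φ, hφ, rfl⟩
    exact hφ

/-- The restriction of a type to a subtuple of its variables, given by `f : α → β`. -/
def restrictVars {L' : FirstOrder.Language} {T' : L'.Theory} {α β : Type*} (f : α → β)
    (p : T'.CompleteType β) : T'.CompleteType α :=
  pullback (LHom.id L') (by
    rintro _ ⟨φ, hφ, rfl⟩
    simpa [LHom.onSentence, LHom.onFormula] using hφ) f p

instance isExpansionOn_subtype_val (A : Set M) :
    (L.lhomWithConstantsMap (Subtype.val : A → M)).IsExpansionOn M := by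
  have : (LHom.constantsOnMap (Subtype.val : A → M)).IsExpansionOn M :=
    constantsOnMap_isExpansionOn rfl
  exact LHom.sumMap_isExpansionOn _ _ _

/-- `p ↾ A`: the restriction of a global type to the parameter set `A`. -/
def restrictParams (A : Set M) {α : Type*} (p : GlobalType L M α) : TypeOver L A α :=
  pullback (L.lhomWithConstantsMap (Subtype.val : A → M)) (by
    rintro _ ⟨φ, hφ, rfl⟩
    exact (LHom.realize_onSentence M _ φ).2 hφ) id p

/-- `tp(b/A)`. -/
def tp (L : FirstOrder.Language.{u, v}) {M : Type w} [L.Structure M] [Nonempty M] (A : Set M)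
    {α : Type*} (b : α → M) : TypeOver L A α :=
  (L[[A]].completeTheory M).typeOf b

/-! ## Monster models -/

/-- `M` is `κ`-saturated: every type in finitely many variables over fewer than `κ` parameters
is realized. -/
def IsSaturated (L : FirstOrder.Language.{u, v}) (M : Type w) [L.Structure M] [Nonempty M]
    (κ : Cardinal.{w}) : Prop :=
  ∀ (A : Set M), #A < κ → ∀ (n : ℕ) (p : TypeOver L A (Fin n)), ∃ b : Fin n → M, tp L A b = p

/-- `M` is strongly `κ`-homogeneous: two tuples of length less than `κ` with the same type over
the empty set are conjugate under an automorphism. -/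
def IsStronglyHomogeneous (L : FirstOrder.Language.{u, v}) (M : Type w) [L.Structure M]
    (κ : Cardinal.{w}) : Prop :=
  ∀ (ι : Type w), #ι < κ → ∀ b c : ι → M,
    (∀ φ : L.Formula ι, φ.Realize b ↔ φ.Realize c) → ∃ σ : M ≃[L] M, ∀ i, σ (b i) = c i

/-! ## Invariant types -/

/-- The global type `p` is `A`-invariant, i.e. fixed by the action of `Aut(M/A)` on parameters. -/
def IsInvariant (A : Set M) {α : Type*} (p : GlobalType L M α) : Prop :=
  ∀ σ : M ≃[L] M, (∀ a ∈ A, σ a = a) → ∀ φ : L[[M]][[α]].Sentence,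
    (translate (L.lhomWithConstantsMap (σ : M → M)) id).onSentence φ ∈ p ↔ φ ∈ p

variable [Nonempty M]

/-- `a` is `i`-independent from the set `C` over `A`: `tp(a/AC)` extends to a global
`A`-invariant type. -/
def InvIndep (L : FirstOrder.Language.{u, v}) {M : Type w} [L.Structure M] [Nonempty M] (A : Set M)
    {α : Type*} (a : α → M) (C : Set M) : Prop :=
  ∃ p : GlobalType L M α, IsInvariant A p ∧ restrictParams (A ∪ C) p = tp L (A ∪ C) a

/-- `(b_i)_{i<n}` is an invariant sequence over `A`. -/
def IsInvariantSequence (L : FirstOrder.Language.{u, v}) {M : Type w} [L.Structure M] [Nonempty M]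
    (A : Set M) {α : Type*} {n : ℕ} (b : Fin n → α → M) : Prop :=
  (∀ i j, tp L A (b i) = tp L A (b j)) ∧
    ∀ i, InvIndep L A (b i) (⋃ j < i, Set.range (b j))

/-- The global type `p` is extendibly `A`-invariant, where the tuples of variables considered have
length less than `ν`. -/
def IsExtendiblyInvariant (ν : Cardinal.{w}) (A : Set M) {α : Type w}
    (p : GlobalType L M α) : Prop :=
  ∀ β : Type w, #β < ν → ∀ q : TypeOver L A (α ⊕ β),
    restrictVars Sum.inl q = restrictParams A p →
      ∃ r : GlobalType L M (α ⊕ β), IsInvariant A r ∧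
        restrictVars Sum.inl r = p ∧ restrictParams A r = q

/-- The closure conditions in the definition of reliability, for a class `R` of global types in
tuples of variables of length less than `ν`. -/
structure IsReliableClass (ν : Cardinal.{w}) (A : Set M)
    (R : ∀ α : Type w, Set (GlobalType L M α)) : Prop where
  /-- `R` is closed under restriction to subtuples (up to renaming of variables). -/
  restrict : ∀ {α β : Type w}, #β < ν → ∀ (f : α ↪ β), ∀ p ∈ R β, restrictVars f p ∈ R α
  /-- If `p(x) ∈ R` and `q(x,y) ∈ S(A)` extends `p ↾ A`, then some `r(x,y) ∈ R` extends
  `p(x) ∪ q(x,y)`. -/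
  extend : ∀ {α β : Type w}, #α < ν → #β < ν → ∀ p ∈ R α, ∀ q : TypeOver L A (α ⊕ β),
    restrictVars Sum.inl q = restrictParams A p →
      ∃ r ∈ R (α ⊕ β), restrictVars Sum.inl r = p ∧ restrictParams A r = q
  /-- If `p(x₀) ∈ R` and `q(x₀,…,xₙ) ∈ S(A)` extends `p ↾ A` and is the type of an invariant
  sequence over `A`, then some `r(x₀,…,xₙ) ∈ R` extends `p(x₀) ∪ ⋯ ∪ p(xₙ) ∪ q(x₀,…,xₙ)`. -/
  spread : ∀ {α : Type w}, #α < ν → ∀ p ∈ R α, ∀ (n : ℕ) (q : TypeOver L A (Fin (n + 1) × α)),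
    restrictVars (fun x => (0, x)) q = restrictParams A p →
    (∃ b : Fin (n + 1) → α → M, IsInvariantSequence L A b ∧
      tp L A (fun ix : Fin (n + 1) × α => b ix.1 ix.2) = q) →
      ∃ r ∈ R (Fin (n + 1) × α),
        (∀ i, restrictVars (fun x => (i, x)) r = p) ∧ restrictParams A r = q

/-- The class of types that are reliably in `I`: the union of all classes contained in `I` with
the above closure conditions. -/
def reliablyIn (ν : Cardinal.{w}) (A : Set M) (I : ∀ α : Type w, Set (GlobalType L M α)) :
    ∀ α : Type w, Set (GlobalType L M α) :=
  fun α => {p | ∃ R : ∀ α : Type w, Set (GlobalType L M α),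
    (∀ α, R α ⊆ I α) ∧ IsReliableClass ν A R ∧ p ∈ R α}

/-- `reliablyIn ν A I` is the largest subclass of `I` with the closure conditions. -/
theorem reliablyIn_largest (ν : Cardinal.{w}) (A : Set M)
    (I : ∀ α : Type w, Set (GlobalType L M α)) :
    (∀ α, reliablyIn ν A I α ⊆ I α) ∧ IsReliableClass ν A (reliablyIn ν A I) ∧
      ∀ R : ∀ α : Type w, Set (GlobalType L M α), (∀ α, R α ⊆ I α) → IsReliableClass ν A R →
        ∀ α, R α ⊆ reliablyIn ν A I α := by
  refine ⟨?_, ⟨?_, ?_, ?_⟩, fun R hI hR α p hp => ⟨R, hI, hR, hp⟩⟩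
  · rintro α p ⟨R, hI, -, hp⟩
    exact hI α hp
  · rintro α β hβ f p ⟨R, hI, hR, hp⟩
    exact ⟨R, hI, hR, hR.restrict hβ f p hp⟩
  · rintro α β hα hβ p ⟨R, hI, hR, hp⟩ q hq
    obtain ⟨r, hr, h⟩ := hR.extend hα hβ p hp q hq
    exact ⟨r, ⟨R, hI, hR, hr⟩, h⟩
  · rintro α hα p ⟨R, hI, hR, hp⟩ n q hq hb
    obtain ⟨r, hr, h⟩ := hR.spread hα p hp n q hq hb
    exact ⟨r, ⟨R, hI, hR, hr⟩, h⟩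

/-- The global type `p` is reliably `A`-invariant. -/
def IsReliablyInvariant (ν : Cardinal.{w}) (A : Set M) {α : Type w}
    (p : GlobalType L M α) : Prop :=
  p ∈ reliablyIn ν A (fun _ => {r | IsInvariant A r}) α

/-! ## Morley sequences and Kim-dividing -/

/-- `(e_i)_{i<ω}` is a Morley sequence over `A` generated by `p`: `e_i ⊨ p ↾ A e_{<i}`. -/
def IsMorleySequence (A : Set M) {α : Type*} (p : GlobalType L M α) (e : ℕ → α → M) : Prop :=
  ∀ i, tp L (A ∪ ⋃ j < i, Set.range (e j)) (e i)
    = restrictParams (A ∪ ⋃ j < i, Set.range (e j)) p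

end Types

section Families

variable {L : FirstOrder.Language.{u, v}} {M : Type w} [L.Structure M]

/-- The set of formulas `{φ(x, b_i) : i ∈ S}` is consistent (finitely satisfiable in `M`). -/
def ConsistentOn {α β ι : Type*} (φ : L.Formula (α ⊕ β)) (b : ι → β → M) (S : Set ι) : Prop :=
  ∀ s : Finset ι, (s : Set ι) ⊆ S → ∃ a : α → M, ∀ i ∈ s, φ.Realize (Sum.elim a (b i))

/-- The family `(φ(x, b_i))_i` is `k`-inconsistent: no `k` members of it (with distinct indices)
are jointly satisfiable. -/
def KInconsistent (k : ℕ) {α β ι : Type*} (φ : L.Formula (α ⊕ β)) (b : ι → β → M) : Prop :=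
  ∀ s : Finset ι, s.card = k → ¬ ∃ a : α → M, ∀ i ∈ s, φ.Realize (Sum.elim a (b i))

/-- `φ(x, y)` `p`-Kim-divides, for an `A`-invariant type `p(y)`: the set `{φ(x, e_i) : i < ω}` is
inconsistent for some (equivalently, in a monster model, every) Morley sequence over `A`
generated by `p`. -/
def KimDivides [Nonempty M] (A : Set M) {α β : Type*} (p : GlobalType L M β)
    (φ : L.Formula (α ⊕ β)) : Prop :=
  ∃ e : ℕ → β → M, IsMorleySequence A p e ∧ ¬ ConsistentOn φ e Set.univ

end Families

/-! ## The comb tree property -/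

/-- The right-combs in the binary tree `2^{<ω}`; `σ <+: τ` says that `τ` extends `σ`. -/
inductive IsRightComb : Set (List Bool) → Prop
  | subsingleton (X : Set (List Bool)) : X.Subsingleton → IsRightComb X
  | step (X : Set (List Bool)) (σ : List Bool) :
      (∀ τ ∈ X, σ <+: τ ∧ τ ≠ σ) →
      (∃! τ, τ ∈ X ∧ σ ++ [false] <+: τ) →
      IsRightComb {τ | τ ∈ X ∧ σ ++ [true] <+: τ} →
      IsRightComb X

/-- `T` has `k`-CTP. -/
def HasKCTP {L : FirstOrder.Language.{u, v}} (T : L.Theory) (k : ℕ) : Prop :=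
  ∃ (M : Theory.ModelType.{u, v, max u v} T) (m n : ℕ) (φ : L.Formula (Fin m ⊕ Fin n))
    (b : List Bool → Fin n → M),
    (∀ α : ℕ → Bool, KInconsistent k φ (fun l : ℕ => b ((List.range l).map α))) ∧
    ∀ X : Set (List Bool), IsRightComb X → ConsistentOn φ b X

/-- `T` has the comb tree property. -/
def HasCTP {L : FirstOrder.Language.{u, v}} (T : L.Theory) : Prop :=
  ∃ k : ℕ, HasKCTP T k

end KimTypes

namespace KimTypes

/-! ### Restriction and transport of types, and realizations in the monster. -/

section Translation

variable {L : FirstOrder.Language.{u, v}}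

/-! For every n the monster contains a tree of height n (`IsCombTree`) whose paths, read from the
top down, are Morley sequences generated by `q`, and whose right-combs, read from the last tooth
back to the first, are Morley sequences generated by `p`. Finite Morley sequences of equal length
are conjugate over `A` (`IsMorleyList.exists_equiv`), so one k makes all paths k-inconsistent, while
all right-combs are consistent. Compactness (`hasKCTP_of_finite`) gives the infinite tree.

The trees are built by induction (`exists_isCombTree`). Along with a tree t one carries a type r in
a reliable class, with r ↾ A = tp(t/A), whose restriction to the variables of each vertex is `p`.
Let t₁ be the given tree and let t₀ realize r over A t₁: every vertex of t₀ then realizes `p` over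
t₁. Since `q` is extendibly invariant, an invariant type s extends `q` in the root variables and r ↾
A in all of them; let t₂ realize s over A t₀ t₁, so that its root realizes `q` over both copies. Now
t₁, t₀, t₂ is an invariant sequence, and reliability puts into the class a type of the triple that
restricts to r on each member. Keeping only the root of t₂, with t₀ on the left and t₁ on the right,
gives the tree of height n + 1 and its type. -/

theorem translate_comp {L₁ L₂ L₃ : FirstOrder.Language} (g : L₂ →ᴸ L₃) (g' : L₁ →ᴸ L₂)
    {α β γ : Type*} (f : β → γ) (f' : α → β) :
    (translate g f).comp (translate g' f') = translate (g.comp g') (f ∘ f') := by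
  refine LHom.funext ?_ ?_
  · funext n x
    rcases x with x | x
    · rfl
    · cases n with
      | zero => rfl
      | succ n => exact isEmptyElim x
  · funext n x
    rcases x with x | x
    · rfl
    · exact isEmptyElim x

theorem lhomWithConstantsMap_comp {α β γ : Type*} (f : β → γ) (f' : α → β) :
    (L.lhomWithConstantsMap f).comp (L.lhomWithConstantsMap f') =
      L.lhomWithConstantsMap (f ∘ f') :=
  translate_comp (LHom.id L) (LHom.id L) f f'

theorem lhomWithConstantsMap_id {α : Type*} :
    L.lhomWithConstantsMap (id : α → α) = LHom.id _ := by
  refine LHom.funext ?_ ?_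
  · funext n x
    rcases x with x | x
    · rfl
    · cases n with
      | zero => rfl
      | succ n => exact isEmptyElim x
  · funext n x
    rcases x with x | x
    · rfl
    · exact isEmptyElim x

theorem translate_id {α : Type*} : translate (LHom.id L) (id : α → α) = LHom.id _ :=
  lhomWithConstantsMap_id

theorem onSentence_onSentence {L₁ L₂ L₃ : FirstOrder.Language} (g : L₂ →ᴸ L₃) (g' : L₁ →ᴸ L₂)
    (ψ : L₁.Sentence) : g.onSentence (g'.onSentence ψ) = (g.comp g').onSentence ψ := by
  simp only [LHom.onSentence, LHom.onFormula, LHom.comp_onBoundedFormula, Function.comp]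

theorem translate_onSentence {L₁ L₂ L₃ : FirstOrder.Language} (g : L₂ →ᴸ L₃) (g' : L₁ →ᴸ L₂)
    {α β γ : Type*} (f : β → γ) (f' : α → β) (ψ : L₁[[α]].Sentence) :
    (translate g f).onSentence ((translate g' f').onSentence ψ) =
      (translate (g.comp g') (f ∘ f')).onSentence ψ := by
  rw [onSentence_onSentence, translate_comp]

theorem id_onSentence (ψ : L.Sentence) : (LHom.id L).onSentence ψ = ψ := by
  simp [LHom.onSentence, LHom.onFormula]

theorem mem_restrictVars {T : L.Theory} {α β : Type*} (f : α → β) (p : T.CompleteType β)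
    (ψ : L[[α]].Sentence) :
    ψ ∈ restrictVars f p ↔ (translate (LHom.id L) f).onSentence ψ ∈ p := Iff.rfl

theorem restrictVars_restrictVars {T : L.Theory} {α β γ : Type*} (f : α → β) (g : β → γ)
    (p : T.CompleteType γ) : restrictVars f (restrictVars g p) = restrictVars (g ∘ f) p := by
  refine SetLike.ext fun ψ => ?_
  rw [mem_restrictVars, mem_restrictVars, mem_restrictVars, translate_onSentence, LHom.comp_id]

theorem restrictVars_id {T : L.Theory} {α : Type*} (p : T.CompleteType α) :
    restrictVars id p = p := by
  refine SetLike.ext fun ψ => ?_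
  rw [mem_restrictVars, translate_id, id_onSentence]

variable {M : Type w} [L.Structure M]

theorem mem_restrictParams (A : Set M) {α : Type*} (p : GlobalType L M α)
    (ψ : L[[A]][[α]].Sentence) : ψ ∈ restrictParams A p ↔
      (translate (L.lhomWithConstantsMap (Subtype.val : A → M)) id).onSentence ψ ∈ p := Iff.rfl

theorem restrictParams_restrictVars (A : Set M) {α β : Type*} (f : α → β) (p : GlobalType L M β) :
    restrictParams A (restrictVars f p) = restrictVars f (restrictParams A p) := by
  refine SetLike.ext fun ψ => ?_
  rw [mem_restrictParams, mem_restrictVars, mem_restrictVars, mem_restrictParams,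
    translate_onSentence, translate_onSentence, LHom.id_comp, LHom.comp_id]
  rfl

/-- Truth in `M` of a sentence in constants for parameters, interpreted by `d`, and for variables,
interpreted by `b`. -/
def Holds {D β : Type*} (d : D → M) (b : β → M) (ψ : L[[D]][[β]].Sentence) : Prop :=
  let : (constantsOn D).Structure M := constantsOn.structure d
  let : (constantsOn β).Structure M := constantsOn.structure b
  M ⊨ ψ

theorem holds_translate {C D α β : Type*} (d : D → M) (b : β → M) (f : C → D) (g : α → β)
    (ψ : L[[C]][[α]].Sentence) :
    Holds d b ((translate (L.lhomWithConstantsMap f) g).onSentence ψ) ↔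
      Holds (d ∘ f) (b ∘ g) ψ := by
  let : (constantsOn D).Structure M := constantsOn.structure d
  let : (constantsOn β).Structure M := constantsOn.structure b
  let : (constantsOn C).Structure M := constantsOn.structure (d ∘ f)
  let : (constantsOn α).Structure M := constantsOn.structure (b ∘ g)
  have : (LHom.constantsOnMap f).IsExpansionOn M := constantsOnMap_isExpansionOn rfl
  have : (LHom.constantsOnMap g).IsExpansionOn M := constantsOnMap_isExpansionOn rfl
  have : (L.lhomWithConstantsMap f).IsExpansionOn M := LHom.sumMap_isExpansionOn _ _ _
  have : (translate (L.lhomWithConstantsMap f) g).IsExpansionOn M :=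
    LHom.sumMap_isExpansionOn _ _ _
  exact LHom.realize_onSentence M _ ψ

theorem holds_equivSentence {D β : Type*} (d : D → M) (b : β → M) (φ : L.Formula (D ⊕ β)) :
    Holds d b (Formula.equivSentence (BoundedFormula.constantsVarsEquiv.symm φ)) ↔
      φ.Realize (Sum.elim d b) := by
  let : (constantsOn D).Structure M := constantsOn.structure d
  let : (constantsOn β).Structure M := constantsOn.structure b
  refine (Formula.realize_equivSentence M _).trans ?_
  rw [Formula.Realize, ← BoundedFormula.realize_constantsVarsEquiv, Equiv.apply_symm_apply]
  rfl

theorem holds_iff_realize {D β : Type*} (d : D → M) (b : β → M) (ψ : L[[D]][[β]].Sentence) :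
    Holds d b ψ ↔ Formula.Realize
      (BoundedFormula.constantsVarsEquiv (Formula.equivSentence.symm ψ) : L.Formula (D ⊕ β))
      (Sum.elim d b) := by
  rw [← holds_equivSentence, Equiv.symm_apply_apply, Equiv.apply_symm_apply]

theorem holds_equiv {D β : Type*} (σ : M ≃[L] M) (d : D → M) (b : β → M)
    (ψ : L[[D]][[β]].Sentence) : Holds (σ ∘ d) (σ ∘ b) ψ ↔ Holds d b ψ := by
  rw [holds_iff_realize, holds_iff_realize, ← Sum.comp_elim]
  exact StrongHomClass.realize_formula σ _

theorem IsInvariant.restrictVars {A : Set M} {α β : Type*} {p : GlobalType L M β}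
    (hp : IsInvariant A p) (f : α → β) : IsInvariant A (restrictVars f p) := by
  intro σ hσ φ
  rw [mem_restrictVars, mem_restrictVars, ← hp σ hσ ((translate (LHom.id _) f).onSentence φ),
    translate_onSentence, translate_onSentence, LHom.id_comp, LHom.comp_id]
  rfl

/-- Extend by an empty tuple of variables: `p` is then a restriction of an invariant type. -/
theorem IsExtendiblyInvariant.isInvariant {ν : Cardinal.{w}} (hν : ℵ₀ ≤ ν) {A : Set M}
    {α : Type w} {p : GlobalType L M α} (hp : IsExtendiblyInvariant ν A p) : IsInvariant A p := by
  have hcard : #PEmpty.{w + 1} < ν := by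
    rw [mk_eq_zero]
    exact aleph0_pos.trans_le hν
  obtain ⟨r, hr, hrp, -⟩ := hp PEmpty hcard
    (KimTypes.restrictVars (_root_.Equiv.sumEmpty α PEmpty.{w + 1}) (restrictParams A p)) (by
      rw [restrictVars_restrictVars]
      exact restrictVars_id _)
  exact hrp ▸ hr.restrictVars Sum.inl

variable [Nonempty M]

theorem mem_tp (A : Set M) {α : Type*} (b : α → M) (ψ : L[[A]][[α]].Sentence) :
    ψ ∈ tp L A b ↔ Holds Subtype.val b ψ := by
  let : (constantsOn α).Structure M := constantsOn.structure b
  exact mem_completeTheory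

theorem restrictVars_tp (A : Set M) {α β : Type*} (f : α → β) (b : β → M) :
    restrictVars f (tp L A b) = tp L A (b ∘ f) := by
  refine SetLike.ext fun ψ => ?_
  rw [mem_restrictVars, mem_tp, mem_tp, ← lhomWithConstantsMap_id, holds_translate]
  rfl

/-- `c` realizes `p ↾ C`. -/
def Realizes {α : Type*} (p : GlobalType L M α) (C : Set M) (c : α → M) : Prop :=
  tp L C c = restrictParams C p

theorem realizes_iff {α : Type*} {p : GlobalType L M α} {C : Set M} {c : α → M} :
    Realizes p C c ↔ ∀ ψ : L[[C]][[α]].Sentence, Holds Subtype.val c ψ ↔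
      (translate (L.lhomWithConstantsMap (Subtype.val : C → M)) id).onSentence ψ ∈ p := by
  refine SetLike.ext_iff.trans (forall_congr' fun ψ => ?_)
  rw [mem_tp, mem_restrictParams]

/-- Naming parameters by an arbitrary family lets the base be shrunk or moved by an automorphism. -/
theorem Realizes.holds_iff {α D : Type*} {p : GlobalType L M α} {C : Set M} {c : α → M}
    (h : Realizes p C c) (d : D → M) (hd : ∀ i, d i ∈ C) (ψ : L[[D]][[α]].Sentence) :
    Holds d c ψ ↔ (translate (L.lhomWithConstantsMap d) id).onSentence ψ ∈ p := by
  have := realizes_iff.1 h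
    ((translate (L.lhomWithConstantsMap (fun i => (⟨d i, hd i⟩ : C))) id).onSentence ψ)
  rw [holds_translate, translate_onSentence, lhomWithConstantsMap_comp] at this
  exact this

theorem Realizes.mono {α : Type*} {p : GlobalType L M α} {C D : Set M} {c : α → M}
    (h : Realizes p D c) (hCD : C ⊆ D) : Realizes p C c :=
  realizes_iff.2 (h.holds_iff _ fun i => hCD i.2)

theorem Realizes.restrictVars {α β : Type*} {p : GlobalType L M β} {C : Set M} {c : β → M}
    (h : Realizes p C c) (f : α → β) : Realizes (restrictVars f p) C (c ∘ f) := by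
  rw [Realizes, restrictParams_restrictVars, ← restrictVars_tp, h]

/-- Parameters in `D` are pulled back along `σ` into `C`; invariance says that this does not affect
membership in `p`. -/
theorem Realizes.map {α : Type*} {A : Set M} {p : GlobalType L M α} (hp : IsInvariant A p)
    {C D : Set M} {c : α → M} (h : Realizes p C c) (σ : M ≃[L] M) (hσ : ∀ a ∈ A, σ a = a)
    (hD : ∀ x ∈ D, ∃ y ∈ C, σ y = x) : Realizes p D (σ ∘ c) := by
  choose! g hgC hg using hD
  refine realizes_iff.2 fun ψ => ?_
  have hv : (Subtype.val : D → M) = σ ∘ (fun x : D => g x) := funext fun x => (hg x x.2).symm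
  rw [hv, holds_equiv, h.holds_iff (fun x : D => g x) fun x => hgC x x.2,
    ← lhomWithConstantsMap_comp, ← hp σ hσ, translate_onSentence]
  rfl

theorem exists_equiv_of_tp_eq {κ : Cardinal.{w}} (hκ : ℵ₀ < κ)
    (hhom : IsStronglyHomogeneous L M κ) {C : Set M} (hC : #C < κ) {α : Type w} [Finite α]
    {c c' : α → M} (h : tp L C c = tp L C c') :
    ∃ σ : M ≃[L] M, (∀ a ∈ C, σ a = a) ∧ ∀ i, σ (c i) = c' i := by
  obtain ⟨σ, hσ⟩ := hhom (C ⊕ α)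
    (by
      rw [mk_sum, lift_id, lift_id]
      exact add_lt_of_lt hκ.le hC ((lt_aleph0_of_finite α).trans hκ))
    (Sum.elim Subtype.val c) (Sum.elim Subtype.val c') fun φ => by
      rw [← holds_equivSentence, ← holds_equivSentence, ← mem_tp, ← mem_tp, h]
  exact ⟨σ, fun a ha => hσ (.inl ⟨a, ha⟩), fun i => hσ (.inr i)⟩

theorem exists_tp_eq {κ : Cardinal.{w}} (hsat : IsSaturated L M κ) {C : Set M} (hC : #C < κ)
    {α : Type*} [Finite α] (p : TypeOver L C α) : ∃ c : α → M, tp L C c = p := by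
  obtain ⟨n, ⟨e⟩⟩ := Finite.exists_equiv_fin α
  obtain ⟨b, hb⟩ := hsat C hC n (restrictVars e.symm p)
  refine ⟨b ∘ e, ?_⟩
  rw [← restrictVars_tp, hb, restrictVars_restrictVars, e.symm_comp_self, restrictVars_id]

end Translation

/-! ### Finite Morley sequences and Kim-dividing. -/

section Morley

variable {L : FirstOrder.Language.{u, v}} {M : Type w} [L.Structure M]

theorem realize_comp_equiv {α β : Type*} (φ : L.Formula (α ⊕ β)) (σ : M ≃[L] M) (a : α → M)
    (c : β → M) : φ.Realize (Sum.elim (σ ∘ a) (σ ∘ c)) ↔ φ.Realize (Sum.elim a c) := by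
  rw [← Sum.comp_elim]
  exact StrongHomClass.realize_formula σ _

theorem mk_union_lt {κ : Cardinal.{w}} (hκ : ℵ₀ < κ) {A : Set M} (hA : #A < κ) {C : Set M}
    (hC : C.Finite) : #(A ∪ C : Set M) < κ :=
  (mk_union_le A C).trans_lt (add_lt_of_lt hκ.le hA (hC.lt_aleph0.trans hκ))

theorem finite_biUnion_list {α : Type*} [Finite α] (l : List (α → M)) :
    (⋃ d ∈ l, Set.range d).Finite :=
  l.finite_toSet.biUnion fun _ _ => Set.finite_range _

variable [Nonempty M]

/-- A finite Morley sequence generated by `p`, listed from its last member to its first. -/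
def IsMorleyList (A : Set M) {α : Type*} (p : GlobalType L M α) : List (α → M) → Prop
  | [] => True
  | c :: l => Realizes p (A ∪ ⋃ d ∈ l, Set.range d) c ∧ IsMorleyList A p l

/-- Once the tails are matched by `σ`, invariance makes the image of the head realize `p` over the
same small base as the other head, so homogeneity moves one to the other while fixing that base. -/
theorem IsMorleyList.exists_equiv {κ : Cardinal.{w}} (hκ : ℵ₀ < κ)
    (hhom : IsStronglyHomogeneous L M κ) {A : Set M} (hA : #A < κ) {α : Type w} [Finite α]
    {p : GlobalType L M α} (hp : IsInvariant A p) :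
    ∀ {l l' : List (α → M)}, IsMorleyList A p l → IsMorleyList A p l' → l.length = l'.length →
      ∃ σ : M ≃[L] M, (∀ a ∈ A, σ a = a) ∧ l.map (fun c => σ ∘ c) = l'
  | [], [], _, _, _ => ⟨Language.Equiv.refl L M, fun _ _ => rfl, rfl⟩
  | [], _ :: _, _, _, h => by simp at h
  | _ :: _, [], _, _, h => by simp at h
  | c :: l, c' :: l', hl, hl', h => by
    obtain ⟨σ, hσ, rfl⟩ := IsMorleyList.exists_equiv hκ hhom hA hp hl.2 hl'.2 (by simpa using h)
    have hc : Realizes p (A ∪ ⋃ d ∈ l.map (fun c => σ ∘ c), Set.range d) (σ ∘ c) := by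
      refine hl.1.map hp σ hσ ?_
      rintro x (hx | hx)
      · exact ⟨x, .inl hx, hσ x hx⟩
      · simp only [List.mem_map, Set.mem_iUnion] at hx
        obtain ⟨_, ⟨d, hd, rfl⟩, i, rfl⟩ := hx
        exact ⟨d i, .inr (Set.mem_biUnion hd ⟨i, rfl⟩), rfl⟩
    obtain ⟨τ, hτ, hτc⟩ := exists_equiv_of_tp_eq hκ hhom
      (mk_union_lt hκ hA (finite_biUnion_list _)) (hc.trans hl'.1.symm)
    refine ⟨τ.comp σ, fun a ha => ?_, ?_⟩
    · rw [Language.Equiv.comp_apply, hσ a ha, hτ a (.inl ha)]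
    · rw [List.map_cons]
      congr 1
      · exact funext hτc
      · refine List.map_congr_left fun d hd => funext fun i => ?_
        exact hτ _ (.inr (Set.mem_biUnion (List.mem_map_of_mem hd) ⟨i, rfl⟩))

theorem exists_isMorleySequence {κ : Cardinal.{w}} (hκ : ℵ₀ < κ) (hsat : IsSaturated L M κ)
    {A : Set M} (hA : #A < κ) {α : Type*} [Finite α] (p : GlobalType L M α) :
    ∃ e : ℕ → α → M, IsMorleySequence A p e := by
  choose F hF using fun l : List (α → M) => exists_tp_eq hsat
    (mk_union_lt hκ hA (finite_biUnion_list l))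
    (restrictParams (A ∪ ⋃ d ∈ l, Set.range d) p)
  -- `l n` lists the first `n` terms, latest first, so each term is chosen over all earlier ones.
  let l : ℕ → List (α → M) := fun n => Nat.rec [] (fun _ t => F t :: t) n
  have hl : ∀ n, ∀ j < n, F (l j) ∈ l n := by
    intro n
    induction n with
    | zero => intro j hj; omega
    | succ n ih =>
      intro j hj
      rcases Nat.lt_succ_iff_lt_or_eq.1 hj with h | rfl
      · exact List.mem_cons_of_mem _ (ih j h)
      · exact List.mem_cons_self
  refine ⟨fun n => F (l n), fun i => ?_⟩
  have h : Realizes p (A ∪ ⋃ d ∈ l i, Set.range d) (F (l i)) := hF (l i)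
  refine h.mono (Set.union_subset_union_right _ ?_)
  exact Set.iUnion₂_subset fun j hj => Set.subset_biUnion_of_mem (u := Set.range) (hl i j hj)

theorem IsMorleySequence.isMorleyList {A : Set M} {α : Type*} {p : GlobalType L M α}
    {e : ℕ → α → M} (he : IsMorleySequence A p e) (n : ℕ) :
    IsMorleyList A p ((List.range n).reverse.map e) := by
  induction n with
  | zero => trivial
  | succ n ih =>
    rw [List.range_succ, List.reverse_append, List.reverse_singleton, List.singleton_append,
      List.map_cons]
    refine ⟨?_, ih⟩
    have h : Realizes p (A ∪ ⋃ j < n, Set.range (e j)) (e n) := he n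
    refine h.mono (Set.union_subset_union_right _ (Set.iUnion₂_subset fun d hd => ?_))
    obtain ⟨j, hj, rfl⟩ := List.mem_map.1 hd
    exact Set.subset_biUnion_of_mem (u := fun j => Set.range (e j))
      (show j < n by simpa using hj)

theorem IsMorleyList.exists_realize {κ : Cardinal.{w}} (hκ : ℵ₀ < κ) (hsat : IsSaturated L M κ)
    (hhom : IsStronglyHomogeneous L M κ) {A : Set M} (hA : #A < κ) {α : Type*} {β : Type w}
    [Finite β] {p : GlobalType L M β} (hp : IsInvariant A p) {φ : L.Formula (α ⊕ β)}
    (hφ : ¬ KimDivides A p φ) {l : List (β → M)} (hl : IsMorleyList A p l) :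
    ∃ a : α → M, ∀ c ∈ l, φ.Realize (Sum.elim a c) := by
  obtain ⟨e, he⟩ := exists_isMorleySequence hκ hsat hA p
  have hcons : ConsistentOn φ e Set.univ := by
    by_contra h
    exact hφ ⟨e, he, h⟩
  obtain ⟨a, ha⟩ := hcons (Finset.range l.length) (Set.subset_univ _)
  obtain ⟨σ, -, hσ⟩ := (he.isMorleyList l.length).exists_equiv hκ hhom hA hp hl (by simp)
  refine ⟨σ ∘ a, fun c hc => ?_⟩
  rw [← hσ] at hc
  obtain ⟨_, hd, rfl⟩ := List.mem_map.1 hc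
  obtain ⟨j, hj, rfl⟩ := List.mem_map.1 hd
  exact (realize_comp_equiv φ σ _ _).2 (ha j (by simpa using hj))

/-- A finite inconsistent part of one Morley sequence lies in an initial segment; its length `k`
serves for all sequences by conjugacy. -/
theorem KimDivides.exists_length {κ : Cardinal.{w}} (hκ : ℵ₀ < κ)
    (hhom : IsStronglyHomogeneous L M κ) {A : Set M} (hA : #A < κ) {α : Type*} {β : Type w}
    [Finite β] {q : GlobalType L M β} (hq : IsInvariant A q) {φ : L.Formula (α ⊕ β)}
    (hφ : KimDivides A q φ) :
    ∃ k : ℕ, ∀ l : List (β → M), IsMorleyList A q l → l.length = k →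
      ¬ ∃ a : α → M, ∀ c ∈ l, φ.Realize (Sum.elim a c) := by
  obtain ⟨e, he, hcons⟩ := hφ
  simp only [ConsistentOn, not_forall] at hcons
  obtain ⟨s, -, hs⟩ := hcons
  obtain ⟨k, hk⟩ := s.exists_nat_subset_range
  refine ⟨k, fun l hl hlk ⟨a, ha⟩ => hs ?_⟩
  obtain ⟨σ, -, hσ⟩ := hl.exists_equiv hκ hhom hA hq (he.isMorleyList k) (by simpa using hlk)
  refine ⟨σ ∘ a, fun i hi => ?_⟩
  have hi' : e i ∈ l.map (fun c => σ ∘ c) := by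
    rw [hσ]
    exact List.mem_map_of_mem (by simpa using hk hi)
  obtain ⟨c, hc, hci⟩ := List.mem_map.1 hi'
  rw [← hci]
  exact (realize_comp_equiv φ σ _ _).2 (ha c hc)

end Morley

/-! ### Trees with `q`-Morley paths and `p`-Morley combs. -/

section Tree

variable {L : FirstOrder.Language.{u, v}} {M : Type w} [L.Structure M] [Nonempty M]

/-- In the tree `b` of height `n`, each vertex realizes `q` over `A` and the vertices above it,
and each vertex above `σ0` realizes `p` over `A` and the vertices above `σ1`. -/
structure IsCombTree (A : Set M) {β : Type*} (p q : GlobalType L M β) (n : ℕ)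
    (b : List Bool → β → M) : Prop where
  path : ∀ σ, σ.length ≤ n →
    Realizes q (A ∪ ⋃ τ ∈ {τ | σ <+: τ ∧ τ ≠ σ ∧ τ.length ≤ n}, Set.range (b τ)) (b σ)
  comb : ∀ σ τ, τ.length ≤ n → σ ++ [false] <+: τ →
    Realizes p (A ∪ ⋃ ρ ∈ {ρ | σ ++ [true] <+: ρ ∧ ρ.length ≤ n}, Set.range (b ρ)) (b τ)

theorem IsCombTree.map {A : Set M} {β : Type*} {p q : GlobalType L M β} (hp : IsInvariant A p)
    (hq : IsInvariant A q) {n : ℕ} {b : List Bool → β → M} (h : IsCombTree A p q n b)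
    (σ : M ≃[L] M) (hσ : ∀ a ∈ A, σ a = a) : IsCombTree A p q n (fun τ => σ ∘ b τ) := by
  have key : ∀ S : Set (List Bool), ∀ x ∈ A ∪ ⋃ τ ∈ S, Set.range (σ ∘ b τ),
      ∃ y ∈ A ∪ ⋃ τ ∈ S, Set.range (b τ), σ y = x := by
    rintro S x (hx | hx)
    · exact ⟨x, .inl hx, hσ x hx⟩
    · obtain ⟨τ, hτ, i, rfl⟩ := Set.mem_iUnion₂.1 hx
      exact ⟨b τ i, .inr (Set.mem_biUnion hτ ⟨i, rfl⟩), rfl⟩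
  exact ⟨fun τ hτ => (h.path τ hτ).map hq σ hσ (key _),
    fun τ ρ hρ hτρ => (h.comb τ ρ hρ hτρ).map hp σ hσ (key _)⟩

theorem IsCombTree.succ {A : Set M} {β : Type*} {p q : GlobalType L M β} {n : ℕ}
    {b : List Bool → β → M} (h : ∀ x, IsCombTree A p q n (fun τ => b (x :: τ)))
    (hroot : Realizes q (A ∪ ⋃ τ ∈ {τ : List Bool | τ ≠ []}, Set.range (b τ)) (b []))
    (hcomb : ∀ τ, τ.length ≤ n →
      Realizes p (A ∪ ⋃ ρ : List Bool, Set.range (b (true :: ρ))) (b (false :: τ))) :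
    IsCombTree A p q (n + 1) b := by
  constructor
  · rintro (_ | ⟨x, σ⟩) hσ
    · refine hroot.mono (Set.union_subset_union_right _ ?_)
      exact Set.biUnion_subset_biUnion_left fun τ hτ => hτ.2.1
    · refine ((h x).path σ (by simpa using hσ)).mono (Set.union_subset_union_right _ ?_)
      refine Set.iUnion₂_subset fun τ hτ => ?_
      obtain ⟨ρ, rfl⟩ := hτ.1
      exact Set.subset_biUnion_of_mem (u := fun τ => Set.range (b (x :: τ)))
        (show σ ++ ρ ∈ {τ | σ <+: τ ∧ τ ≠ σ ∧ τ.length ≤ n} from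
          ⟨⟨ρ, rfl⟩, by simpa using hτ.2.1, by simpa using hτ.2.2⟩)
  · rintro (_ | ⟨x, σ⟩) τ hτ ⟨ρ, rfl⟩
    · refine (hcomb ρ (by simpa using hτ)).mono (Set.union_subset_union_right _ ?_)
      refine Set.iUnion₂_subset fun τ hτ => ?_
      obtain ⟨ρ, rfl⟩ := hτ.1
      exact Set.subset_iUnion (fun ρ => Set.range (b (true :: ρ))) ρ
    · refine ((h x).comb σ (σ ++ [false] ++ ρ) (by simpa using hτ) ⟨ρ, rfl⟩).mono
        (Set.union_subset_union_right _ ?_)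
      refine Set.iUnion₂_subset fun τ hτ => ?_
      obtain ⟨ρ, rfl⟩ := hτ.1
      exact Set.subset_biUnion_of_mem (u := fun τ => Set.range (b (x :: τ)))
        (show σ ++ [true] ++ ρ ∈ {ρ | σ ++ [true] <+: ρ ∧ ρ.length ≤ n} from
          ⟨⟨ρ, rfl⟩, by simpa using hτ.2⟩)

/-- Increasing levels put the lowest vertex at the head, the place of the last term of a Morley
sequence. Levels may be skipped, since a vertex realizes `q` over everything above it. -/
theorem IsCombTree.isMorleyList_path {A : Set M} {β : Type*} {p q : GlobalType L M β} {n : ℕ}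
    {b : List Bool → β → M} (h : IsCombTree A p q n b) (α : ℕ → Bool) :
    ∀ l : List ℕ, l.Pairwise (· < ·) → (∀ i ∈ l, i ≤ n) →
      IsMorleyList A q (l.map fun i => b ((List.range i).map α))
  | [], _, _ => trivial
  | i :: l, hl, hn => by
    rw [List.pairwise_cons] at hl
    refine ⟨?_, h.isMorleyList_path α l hl.2 fun j hj => hn j (List.mem_cons_of_mem _ hj)⟩
    refine (h.path _ (by simpa using hn i List.mem_cons_self)).mono
      (Set.union_subset_union_right _ (Set.iUnion₂_subset fun d hd => ?_))
    obtain ⟨j, hj, rfl⟩ := List.mem_map.1 hd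
    have hij := hl.1 j hj
    refine Set.subset_biUnion_of_mem (u := fun τ => Set.range (b τ)) ⟨?_, ?_, ?_⟩
    · obtain ⟨m, rfl⟩ := Nat.exists_eq_add_of_lt hij
      rw [add_assoc, List.range_add, List.map_append]
      exact List.prefix_append _ _
    · intro he
      have := congrArg List.length he
      simp at this
      omega
    · simpa using hn j (List.mem_cons_of_mem _ hj)

/-- If `Y` omits the vertex above σ0, it lies in the smaller comb above σ1. This reduces consistency
of a comb to its finite subcombs. -/
theorem IsRightComb.mono {X Y : Set (List Bool)} (hX : IsRightComb X) (hYX : Y ⊆ X) :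
    IsRightComb Y := by
  induction hX generalizing Y with
  | subsingleton X h => exact .subsingleton _ (h.anti hYX)
  | step X σ h₁ h₂ h₃ ih =>
    obtain ⟨τ, ⟨hτX, hτ⟩, huniq⟩ := h₂
    by_cases hτY : τ ∈ Y
    · exact .step Y σ (fun ρ hρ => h₁ ρ (hYX hρ))
        ⟨τ, ⟨hτY, hτ⟩, fun ρ hρ => huniq ρ ⟨hYX hρ.1, hρ.2⟩⟩
        (ih fun ρ hρ => ⟨hYX hρ.1, hρ.2⟩)
    · refine ih fun ρ hρ => ⟨hYX hρ, ?_⟩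
      obtain ⟨⟨_ | ⟨x, t⟩, rfl⟩, hne⟩ := h₁ ρ (hYX hρ)
      · simp at hne
      · cases x with
        | true => exact ⟨t, by simp⟩
        | false =>
          exact absurd (huniq _ ⟨hYX hρ, t, by simp⟩ ▸ hρ) hτY

theorem IsCombTree.exists_isMorleyList_comb {A : Set M} {β : Type*} {p q : GlobalType L M β}
    (hpq : restrictParams A p = restrictParams A q) {n : ℕ} {b : List Bool → β → M}
    (h : IsCombTree A p q n b) {X : Set (List Bool)} (hX : IsRightComb X)
    (hn : ∀ τ ∈ X, τ.length ≤ n) :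
    ∃ l : List (List Bool), (∀ τ, τ ∈ l ↔ τ ∈ X) ∧ IsMorleyList A p (l.map b) := by
  induction hX with
  | subsingleton X hX =>
    rcases hX.eq_empty_or_singleton with rfl | ⟨τ, rfl⟩
    · exact ⟨[], by simp, trivial⟩
    · refine ⟨[τ], by simp, ?_, trivial⟩
      -- The tree only says that `τ` realizes `q`; over `A` this is the same as `p`.
      have h' := (h.path τ (hn τ rfl)).mono Set.subset_union_left
      have h'' : Realizes p A (b τ) := h'.trans hpq.symm
      exact h''.mono (by simp)
  | step X σ h₁ h₂ h₃ ih =>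
    obtain ⟨τ, ⟨hτX, hτ⟩, huniq⟩ := h₂
    obtain ⟨l, hl, hlm⟩ := ih fun ρ hρ => hn ρ hρ.1
    refine ⟨τ :: l, fun ρ => ?_, ?_, hlm⟩
    · rw [List.mem_cons, hl]
      constructor
      · rintro (rfl | hρ)
        · exact hτX
        · exact hρ.1
      · intro hρ
        obtain ⟨⟨_ | ⟨x, t⟩, rfl⟩, hne⟩ := h₁ ρ hρ
        · simp at hne
        · cases x with
          | true => exact .inr ⟨hρ, t, by simp⟩
          | false => exact .inl (huniq _ ⟨hρ, t, by simp⟩)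
    · refine (h.comb σ τ (hn τ hτX) hτ).mono
        (Set.union_subset_union_right _ (Set.iUnion₂_subset fun d hd => ?_))
      obtain ⟨ρ, hρ, rfl⟩ := List.mem_map.1 hd
      have hρ' := (hl ρ).1 hρ
      exact Set.subset_biUnion_of_mem (u := fun τ => Set.range (b τ)) ⟨hρ'.2, hn ρ hρ'.1⟩

/-- The root variables are kept as the summand `β`, so that extendibility of `q` applies to `q` in
`β` with `γ` as the extra variables. Values of `node` beyond level `n` are irrelevant. -/
theorem exists_isCombTree {κ : Cardinal.{w}} (hκ : ℵ₀ < κ) (hsat : IsSaturated L M κ)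
    (hhom : IsStronglyHomogeneous L M κ) {A : Set M} (hA : #A < κ) {ν : Cardinal.{w}}
    (hν : ℵ₀ ≤ ν) {β : Type w} [Finite β] {p q : GlobalType L M β}
    {R : ∀ α : Type w, Set (GlobalType L M α)} (hRI : ∀ α, R α ⊆ {r | IsInvariant A r})
    (hR : IsReliableClass ν A R) (hp : p ∈ R β) (hq : IsExtendiblyInvariant ν A q)
    (hqinv : IsInvariant A q) (hpq : restrictParams A p = restrictParams A q) (n : ℕ) :
    ∃ (γ : Type w) (_ : Finite γ) (node : List Bool → β → β ⊕ γ),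
      node [] = Sum.inl ∧ ∃ r ∈ R (β ⊕ γ), (∀ σ, σ.length ≤ n → restrictVars (node σ) r = p) ∧
        ∃ t : β ⊕ γ → M, tp L A t = restrictParams A r ∧
          IsCombTree A p q n (fun σ => t ∘ node σ) := by
  have hfin : ∀ γ : Type w, Finite γ → #γ < ν := fun γ _ => (lt_aleph0_of_finite γ).trans_le hν
  induction n with
  | zero =>
    let e : β ⊕ PEmpty.{w + 1} ↪ β := (_root_.Equiv.sumEmpty β PEmpty).toEmbedding
    have he : restrictVars Sum.inl (restrictVars e p) = p := by
      rw [restrictVars_restrictVars]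
      exact restrictVars_id p
    refine ⟨PEmpty, inferInstance, fun _ => Sum.inl, rfl, restrictVars e p,
      hR.restrict (hfin β inferInstance) e p hp, fun _ _ => he, ?_⟩
    obtain ⟨t, ht⟩ := exists_tp_eq hsat hA (restrictParams A (restrictVars e p))
    refine ⟨t, ht, ?_, ?_⟩
    · intro σ hσ
      have h : Realizes (restrictVars Sum.inl (restrictVars e p)) A (t ∘ Sum.inl) :=
        Realizes.restrictVars ht Sum.inl
      rw [he] at h
      have h' : Realizes q A (t ∘ Sum.inl) := h.trans hpq
      refine h'.mono (Set.union_subset subset_rfl (Set.iUnion₂_subset fun τ hτ => ?_))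
      have h₁ := List.eq_nil_of_length_eq_zero (Nat.le_zero.1 hσ)
      have h₂ := List.eq_nil_of_length_eq_zero (Nat.le_zero.1 hτ.2.2)
      exact absurd (h₂.trans h₁.symm) hτ.2.1
    · rintro σ τ hτ ⟨ρ, rfl⟩
      simp at hτ
  | succ n ih =>
    obtain ⟨γ, hγ, node, hnode, r, hr, hrp, t₁, ht₁, htree⟩ := ih
    have hcard : ∀ {C : Set M}, C.Finite → #(A ∪ C : Set M) < κ := fun hC => mk_union_lt hκ hA hC
    have hrange : ∀ t : β ⊕ γ → M, (Set.range t).Finite := fun t => Set.finite_range t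
    obtain ⟨t₀, ht₀⟩ := exists_tp_eq hsat (hcard (hrange t₁))
      (restrictParams (A ∪ Set.range t₁) r)
    replace ht₀ : Realizes r (A ∪ Set.range t₁) t₀ := ht₀
    have ht₀A : Realizes r A t₀ := ht₀.mono Set.subset_union_left
    have hrroot : restrictVars Sum.inl r = p := hnode ▸ hrp [] (Nat.zero_le _)
    -- On the root variables `r` is `p`, which agrees with `q` over `A`, so the type of the whole
    -- tree over `A` may be attached to `q`.
    obtain ⟨s, hs, hsq, hsr⟩ := hq γ (hfin γ hγ) (restrictParams A r) (by
      rw [← restrictParams_restrictVars, hrroot, hpq])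
    obtain ⟨t₂, ht₂⟩ := exists_tp_eq hsat (hcard ((hrange t₀).union (hrange t₁)))
      (restrictParams (A ∪ (Set.range t₀ ∪ Set.range t₁)) s)
    replace ht₂ : Realizes s (A ∪ (Set.range t₀ ∪ Set.range t₁)) t₂ := ht₂
    have ht₂A : tp L A t₂ = restrictParams A r := (ht₂.mono Set.subset_union_left).trans hsr
    let c : Fin 3 → β ⊕ γ → M := ![t₁, t₀, t₂]
    have hc : ∀ i, tp L A (c i) = restrictParams A r := by
      intro i
      fin_cases i
      exacts [ht₁, ht₀A, ht₂A]
    have hseq : IsInvariantSequence L A c := by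
      refine ⟨fun i j => (hc i).trans (hc j).symm, fun i => ?_⟩
      fin_cases i
      · refine ⟨r, hRI _ hr, Eq.symm ?_⟩
        have h : Realizes r A t₁ := ht₁
        exact h.mono (Set.union_subset subset_rfl (Set.iUnion₂_subset fun j hj => by
          exact absurd hj (Nat.not_lt_zero _)))
      · refine ⟨r, hRI _ hr, Eq.symm ?_⟩
        refine ht₀.mono (Set.union_subset_union_right _ (Set.iUnion₂_subset fun j hj => ?_))
        fin_cases j
        · exact subset_rfl
        · exact absurd hj (by decide)
        · exact absurd hj (by decide)
      · refine ⟨s, hs, Eq.symm ?_⟩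
        refine ht₂.mono (Set.union_subset_union_right _ (Set.iUnion₂_subset fun j hj => ?_))
        fin_cases j
        · exact Set.subset_union_right
        · exact Set.subset_union_left
        · exact absurd hj (by decide)
    -- Although the tail of the sequence was chosen by `s`, reliability returns a type equal to `r`
    -- on all three copies.
    obtain ⟨r', hr', hr'i, hr'A⟩ := hR.spread (hfin (β ⊕ γ) inferInstance) r hr 2
      (tp L A fun ix : Fin 3 × (β ⊕ γ) => c ix.1 ix.2) (by
        rw [restrictVars_tp]
        exact ht₁) ⟨c, hseq, rfl⟩
    -- Copy 2 contributes only its root; copy 1 is the left subtree and copy 0 the right one.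
    let f : β ⊕ ((β ⊕ γ) ⊕ (β ⊕ γ)) ↪ Fin 3 × (β ⊕ γ) :=
      ⟨Sum.elim (fun x => (2, .inl x)) (Sum.elim (fun x => (1, x)) (fun x => (0, x))), by
        rintro (x | x | x) (y | y | y) h <;> simp_all⟩
    let node' : List Bool → β → β ⊕ ((β ⊕ γ) ⊕ (β ⊕ γ))
      | [] => Sum.inl
      | false :: σ => fun x => .inr (.inl (node σ x))
      | true :: σ => fun x => .inr (.inr (node σ x))
    refine ⟨(β ⊕ γ) ⊕ (β ⊕ γ), inferInstance, node', rfl, restrictVars f r',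
      hR.restrict (hfin _ inferInstance) f r' hr', ?_, (fun ix => c ix.1 ix.2) ∘ f, ?_, ?_⟩
    · intro σ hσ
      rw [restrictVars_restrictVars]
      match σ, hσ with
      | [], _ =>
        have h := restrictVars_restrictVars Sum.inl (fun x => ((2 : Fin 3), x)) r'
        rw [hr'i, hrroot] at h
        exact h.symm
      | false :: σ, hσ =>
        have h := restrictVars_restrictVars (node σ) (fun x => ((1 : Fin 3), x)) r'
        rw [hr'i, hrp σ (by simpa using hσ)] at h
        exact h.symm
      | true :: σ, hσ =>
        have h := restrictVars_restrictVars (node σ) (fun x => ((0 : Fin 3), x)) r'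
        rw [hr'i, hrp σ (by simpa using hσ)] at h
        exact h.symm
    · rw [restrictParams_restrictVars, hr'A, restrictVars_tp]
    -- `t₀` is conjugate to `t₁` over `A`, hence is a tree of the same kind.
    · obtain ⟨σ, hσ, hσt⟩ := exists_equiv_of_tp_eq hκ hhom hA (ht₁.trans ht₀A.symm)
      refine IsCombTree.succ ?_ ?_ ?_
      · rintro (_ | _)
        · have h := htree.map (hRI _ hp) hqinv σ hσ
          have hσt' : ∀ g : β → β ⊕ γ, σ ∘ t₁ ∘ g = t₀ ∘ g := fun g => funext fun x => hσt _
          simp only [hσt'] at h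
          exact h
        · exact htree
      · have h := Realizes.restrictVars ht₂ Sum.inl
        rw [hsq] at h
        refine h.mono (Set.union_subset_union_right _ (Set.iUnion₂_subset fun τ hτ => ?_))
        match τ, hτ with
        | [], hτ => exact absurd rfl hτ
        | false :: τ, _ =>
          rintro _ ⟨i, rfl⟩
          exact .inl ⟨node τ i, rfl⟩
        | true :: τ, _ =>
          rintro _ ⟨i, rfl⟩
          exact .inr ⟨node τ i, rfl⟩
      · intro τ hτ
        -- Here it matters that `r` restricts to `p` at every vertex, not only at the root.
        have h := Realizes.restrictVars ht₀ (node τ)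
        rw [hrp τ hτ] at h
        refine h.mono (Set.union_subset_union_right _ (Set.iUnion_subset fun ρ => ?_))
        rintro _ ⟨i, rfl⟩
        exact ⟨node ρ i, rfl⟩

end Tree

/-! ### From finite trees to the infinite tree. -/

section Compactness

variable {L : FirstOrder.Language.{u, v}}

/-- The formula in the tree of variables `(y_σ)_σ` that says that `{φ(x, y_σ) : σ ∈ s}` is
consistent. -/
noncomputable def consistencyFormula {ι : Type*} {m n : ℕ} (φ : L.Formula (Fin m ⊕ Fin n))
    (s : Finset ι) : L.Formula (ι × Fin n) :=
  Formula.iExs (Fin m) (Formula.iInf fun i : s =>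
    φ.relabel (Sum.elim Sum.inr fun j => Sum.inl ((i : ι), j)))

theorem realize_consistencyFormula {M : Type*} [L.Structure M] {ι : Type*} {m n : ℕ}
    (φ : L.Formula (Fin m ⊕ Fin n)) (s : Finset ι) (b : ι × Fin n → M) :
    (consistencyFormula φ s).Realize b ↔
      ∃ a : Fin m → M, ∀ i ∈ s, φ.Realize (Sum.elim a fun j => b (i, j)) := by
  have h : ∀ (a : Fin m → M) (i : ι),
      Sum.elim b a ∘ (Sum.elim Sum.inr fun j => Sum.inl (i, j) :
        Fin m ⊕ Fin n → (ι × Fin n) ⊕ Fin m) = Sum.elim a fun j => b (i, j) := by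
    intro a i
    funext x
    rcases x with x | x <;> rfl
  simp only [consistencyFormula, Formula.realize_iExs, Formula.realize_iInf,
    Formula.realize_relabel, h, Subtype.forall]

/-- The requirements up to level `N` form an increasing chain of theories, so finding a tree in `M`
for each `N` separately is enough. Compactness also moves the tree to a model in the universe that
`HasKCTP` asks for. -/
theorem hasKCTP_of_finite {T : L.Theory} {M : Type w} [L.Structure M] [Nonempty M] [M ⊨ T]
    {m n : ℕ} (φ : L.Formula (Fin m ⊕ Fin n)) (k : ℕ)
    (h : ∀ N : ℕ, ∃ b : List Bool → Fin n → M,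
      (∀ (α : ℕ → Bool) (s : Finset ℕ), s.card = k → (∀ i ∈ s, i ≤ N) →
        ¬ ∃ a : Fin m → M, ∀ i ∈ s, φ.Realize (Sum.elim a (b ((List.range i).map α)))) ∧
      ∀ s : Finset (List Bool), IsRightComb s → (∀ σ ∈ s, σ.length ≤ N) →
        ∃ a : Fin m → M, ∀ σ ∈ s, φ.Realize (Sum.elim a (b σ))) :
    HasKCTP T k := by
  let Γ : ℕ → L[[List Bool × Fin n]].Theory := fun N =>
    (L.lhomWithConstants (List Bool × Fin n)).onTheory T ∪
      ({ψ | ∃ (α : ℕ → Bool) (s : Finset ℕ), s.card = k ∧ (∀ i ∈ s, i ≤ N) ∧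
          ψ = Formula.equivSentence
            (consistencyFormula φ (s.image fun i => (List.range i).map α)).not} ∪
        {ψ | ∃ s : Finset (List Bool), IsRightComb s ∧ (∀ σ ∈ s, σ.length ≤ N) ∧
          ψ = Formula.equivSentence (consistencyFormula φ s)})
  have hmono : Monotone Γ := by
    intro N N' hN
    refine Set.union_subset_union_right _ (Set.union_subset_union ?_ ?_)
    · rintro _ ⟨α, s, hs, hsN, rfl⟩
      exact ⟨α, s, hs, fun i hi => (hsN i hi).trans hN, rfl⟩
    · rintro _ ⟨s, hs, hsN, rfl⟩
      exact ⟨s, hs, fun i hi => (hsN i hi).trans hN, rfl⟩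
  have hsat : Theory.IsSatisfiable (⋃ N, Γ N) := by
    refine (Theory.isSatisfiable_directed_union_iff hmono.directed_le).2 fun N => ?_
    obtain ⟨b, hb₁, hb₂⟩ := h N
    let : (constantsOn (List Bool × Fin n)).Structure M :=
      constantsOn.structure fun x => b x.1 x.2
    have : M ⊨ Γ N := by
      refine Theory.model_iff _ |>.2 ?_
      rintro ψ (hψ | ⟨α, s, hs, hsN, rfl⟩ | ⟨s, hs, hsN, rfl⟩)
      · have : M ⊨ (L.lhomWithConstants (List Bool × Fin n)).onTheory T :=
          (LHom.onTheory_model _ T).2 inferInstance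
        exact Theory.realize_sentence_of_mem _ hψ
      · refine (Formula.realize_equivSentence M _).2 ?_
        rw [Formula.realize_not, realize_consistencyFormula]
        rintro ⟨a, ha⟩
        exact hb₁ α s hs hsN ⟨a, fun i hi => ha _ (Finset.mem_image_of_mem _ hi)⟩
      · refine (Formula.realize_equivSentence M _).2 ?_
        rw [realize_consistencyFormula]
        exact hb₂ s hs hsN
    exact Theory.Model.isSatisfiable M
  obtain ⟨K⟩ := hsat
  let := (L.lhomWithConstants (List Bool × Fin n)).reduct K
  have hK : ∀ N, ∀ ψ ∈ Γ N, (K : Type _) ⊨ ψ := fun N ψ hψ =>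
    Theory.realize_sentence_of_mem (⋃ N, Γ N) (Set.mem_iUnion_of_mem N hψ)
  have hKT : K ⊨ T := by
    refine (LHom.onTheory_model (L.lhomWithConstants (List Bool × Fin n)) T).1 ?_
    exact Theory.model_iff _ |>.2 fun ψ hψ => hK 0 ψ (.inl hψ)
  refine ⟨Theory.ModelType.of T K, m, n, φ, fun σ j => (L.con (σ, j) : K), ?_, ?_⟩
  · rintro α s hs ⟨a, ha⟩
    -- The level bound `N` is the largest index in `s`.
    have hmem := hK (s.sup id) _ (.inr (.inl ⟨α, s, hs, fun i hi => Finset.le_sup (f := id) hi, rfl⟩))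
    have hreal := (Formula.realize_equivSentence K _).1 hmem
    rw [Formula.realize_not, realize_consistencyFormula] at hreal
    refine hreal ⟨a, fun σ hσ => ?_⟩
    obtain ⟨i, hi, rfl⟩ := Finset.mem_image.1 hσ
    exact ha i hi
  · intro X hX s hs
    have hmem := hK (s.sup List.length) _ (.inr (.inr ⟨s, hX.mono hs,
      fun σ hσ => Finset.le_sup (f := List.length) hσ, rfl⟩))
    have hreal := (Formula.realize_equivSentence K _).1 hmem
    rw [realize_consistencyFormula] at hreal
    exact hreal

end Compactness

end KimTypes

/-! ### The main theorem. -/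

theorem mainTheorem3 {L : FirstOrder.Language.{u, v}} (T : L.Theory)
    (M : Type w) [L.Structure M] [Nonempty M] [M ⊨ T]
    (κ : Cardinal.{w}) (hκ : ℵ₀ < κ)
    (hsat : KimTypes.IsSaturated L M κ) (hhom : KimTypes.IsStronglyHomogeneous L M κ)
    (A : Set M) (hA : #A < κ)
    (ν : Cardinal.{w}) (hν : ℵ₀ ≤ ν) (hνκ : ν ≤ κ)
    {α β : Type w} [Finite α] [Finite β] (φ : L.Formula (α ⊕ β))
    (p q : KimTypes.GlobalType L M β)
    (hp : KimTypes.IsReliablyInvariant ν A p) (hq : KimTypes.IsExtendiblyInvariant ν A q)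
    (hpq : KimTypes.restrictParams A p = KimTypes.restrictParams A q)
    (hdiv : KimTypes.KimDivides A q φ) (hndiv : ¬ KimTypes.KimDivides A p φ) :
    KimTypes.HasCTP T := by
  obtain ⟨R, hRI, hR, hpR⟩ := hp
  have hpinv : KimTypes.IsInvariant A p := hRI _ hpR
  have hqinv : KimTypes.IsInvariant A q := hq.isInvariant hν
  obtain ⟨m, ⟨eα⟩⟩ := Finite.exists_equiv_fin α
  obtain ⟨n, ⟨eβ⟩⟩ := Finite.exists_equiv_fin β
  obtain ⟨k, hk⟩ := hdiv.exists_length hκ hhom hA hqinv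
  -- CTP is stated for tuples indexed by `Fin`, so the variables of `φ` are relabelled.
  have hφ : ∀ (a : α → M) (b : β → M),
      (φ.relabel (Sum.map eα eβ)).Realize (Sum.elim (a ∘ eα.symm) (b ∘ eβ.symm)) ↔
        φ.Realize (Sum.elim a b) := by
    intro a b
    rw [Formula.realize_relabel, Sum.elim_comp_map, Function.comp_assoc, Function.comp_assoc,
      eα.symm_comp_self, eβ.symm_comp_self, Function.comp_id, Function.comp_id]
  refine ⟨k, KimTypes.hasKCTP_of_finite (M := M) (φ.relabel (Sum.map eα eβ)) k fun N => ?_⟩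
  obtain ⟨γ, -, node, -, r, -, -, t, -, htree⟩ :=
    KimTypes.exists_isCombTree hκ hsat hhom hA hν hRI hR hpR hq hqinv hpq N
  refine ⟨fun σ => (t ∘ node σ) ∘ eβ.symm, ?_, ?_⟩
  · rintro ε s hs hsN ⟨a, ha⟩
    refine hk _ (htree.isMorleyList_path ε (s.sort (· ≤ ·)) (s.sortedLT_sort.pairwise)
      (by simpa using hsN)) (by simpa using hs) ⟨a ∘ eα, fun c hc => ?_⟩
    obtain ⟨i, hi, rfl⟩ := List.mem_map.1 hc
    rw [← hφ, Function.comp_assoc, eα.self_comp_symm, Function.comp_id]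
    exact ha i (by simpa using hi)
  · intro s hs hsN
    obtain ⟨l, hl, hlm⟩ := htree.exists_isMorleyList_comb hpq hs hsN
    obtain ⟨a, ha⟩ := hlm.exists_realize hκ hsat hhom hA hpinv hndiv
    exact ⟨a ∘ eα.symm, fun σ hσ => (hφ _ _).2 (ha _ (List.mem_map_of_mem ((hl σ).2 hσ)))⟩
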